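/- Let $\mathcal H$ be a complex Hilbert space with inner product $\langle\cdot,\cdot\rangle$ antilinear in the first argument. An operator $A$ in $\mathcal H$ with domain $\operatorname{dom}(A)$ (not necessarily dense) is identified with its graph in $\mathcal H\oplus\mathcal H$, and $A^*:=\{(\eta,\omega):\langle\eta,A\varphi\rangle=\langle\omega,\varphi\rangle\ \text{for all }\varphi\in\operatorname{dom}(A)\}$ is in general a linear relation. Let $\mathscr S(\mathcal H)$ be the set of operators $A$ that are closed, symmetric ($A\subset A^*$), regular (for each $z\in\mathbb C$ there is $c_z>0$ with $\|(A-zI)\varphi\|\ge c_z\|\varphi\|$ for all $\varphi\in\operatorname{dom}(A)$), and have both deficiency indices equal to one ($\dim[\mathcal H\ominus\operatorname{ran}(A-zI)]=1$ for all $z\in\mathbb C\setminus\mathbb R$). For an integer $n\ge 0$, $\mathscr E_n$ is the set of $A\in\mathscr S(\mathcal H)$ for which there are $\mu_0,\dots,\mu_n\in\mathcal H$ such that $$\mathcal H=\operatorname{ran}(A-zI)\dotplus\operatorname{span}\{\mu_0+z\mu_1+\cdots+z^n\mu_n\}\quad\text{for all }z\in\mathbb C,$$ and for $n\ge 1$,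 $\mathscr E_{-n}$ is the set of $A\in\mathscr E_0$ for which there is $\mu\in\operatorname{dom}(A^n)$ such that $\mathcal H=\operatorname{ran}(A-zI)\dotplus\operatorname{span}\{\mu\}$ for all $z\in\mathbb C$. Let $A\in\mathscr S(\mathcal H)$. Let $J$ be an involution of $\mathcal H$ (an antilinear map with $J^2=I$ and $\langle J\psi,J\varphi\rangle=\langle\varphi,\psi\rangle$) that commutes with every selfadjoint linear relation $T$ with $A\subset T=T^*$ in $\mathcal H\oplus\mathcal H$, that is, $J(T-zI)^{-1}\varphi=(T-\overline zI)^{-1}J\varphi$ for all $\varphi\in\mathcal H$ and $z\in\mathbb C\setminus\mathbb R$. Let $\xi_A:\mathbb C\to\mathcal H$ be an entire function without zeros such that $\xi_A(z)\in\ker(A^*-zI)$ and $J\xi_A(z)=\xi_A(\overline z)$ for all $z\in\mathbb C$. Put $(\Phi_A\varphi)(z):=\langle\xi_A(\overline z),\varphi\rangle$ for $\varphi\in\mathcal H$, and $\widehat{\mathcal H}:=\Phi_A\mathcal H$, a linear space of entire functions. Let $S$ be the operator of multiplication by the independent variable in $\widehat{\mathcal H}$, with $\operatorname{dom}(S)=\{f\in\widehat{\mathcal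 H}: zf(z)\in\widehat{\mathcal H}\}$. For $n\in\mathbb Z$ let $$\operatorname{assoc}_n\widehat{\mathcal H}:=\begin{cases}\widehat{\mathcal H}+z\widehat{\mathcal H}+\cdots+z^n\widehat{\mathcal H}, & n\ge 0,\\ \operatorname{dom}(S^{|n|}), & n<0.\end{cases}$$ Then, for every $n\in\mathbb Z$, $A\in\mathscr E_n$ if and only if $\operatorname{assoc}_n\widehat{\mathcal H}$ contains an entire function without zeros. -/

import Mathlib

namespace NEntire

open scoped ComplexConjugate InnerProductSpace

noncomputable section

/-! ### Operators and linear relations in a Hilbert space -/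

section Operators

variable {H : Type*} [NormedAddCommGroup H] [InnerProductSpace ℂ H]

/-- `A - zI`, as a linear map on `dom A`. -/
def subScalar (A : H →ₗ.[ℂ] H) (z : ℂ) : A.domain →ₗ[ℂ] H :=
  A.toFun - z • A.domain.subtype

/-- `ran (A - zI)`. -/
def ran (A : H →ₗ.[ℂ] H) (z : ℂ) : Submodule ℂ H :=
  LinearMap.range (subScalar A z)

/-- The operator `A`, not necessarily densely defined, is symmetric: `A ⊆ A*`, where the adjoint
`A*` is a linear relation. -/
def IsSymmetricOp (A : H →ₗ.[ℂ] H) : Prop :=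
  A.graph ≤ A.graph.adjoint

/-- Every complex number is a point of regular type of `A`. -/
def IsRegularOp (A : H →ₗ.[ℂ] H) : Prop :=
  ∀ z : ℂ, ∃ c : ℝ, 0 < c ∧ ∀ φ : A.domain, c * ‖(φ : H)‖ ≤ ‖A φ - z • (φ : H)‖

/-- Both deficiency indices of `A` are equal to one: `H ⊖ ran (A - zI)` is one dimensional for
all `z` in the open upper and the open lower half-plane. -/
def HasDeficiencyIndicesOne (A : H →ₗ.[ℂ] H) : Prop :=
  (∀ z : ℂ, 0 < z.im → Module.finrank ℂ (ran A z)ᗮ = 1) ∧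
  (∀ z : ℂ, z.im < 0 → Module.finrank ℂ (ran A z)ᗮ = 1)

/-- The domain of the power `T ^ n` of an operator `T` acting within `E`. -/
def domPow {E : Type*} [AddCommGroup E] [Module ℂ E] (T : E →ₗ.[ℂ] E) : ℕ → Submodule ℂ E
  | 0 => ⊤
  | n + 1 => ((domPow T n).comap T.toFun).map T.domain.subtype

/-- A canonical selfadjoint extension of `A`: a selfadjoint linear relation in `H` that
extends `A`. -/
def IsCanonicalSelfadjointExtension (A : H →ₗ.[ℂ] H) (T : Submodule ℂ (H × H)) : Prop :=
  A.graph ≤ T ∧ T.adjoint = T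

/-- `η = (T - zI)⁻¹ φ`, in the sense of relations. -/
def ResolventRel (T : Submodule ℂ (H × H)) (z : ℂ) (φ η : H) : Prop :=
  (η, φ + z • η) ∈ T

/-- An involution: an antilinear map `J` with `J² = I` and `⟪Jψ, Jφ⟫ = ⟪φ, ψ⟫`. -/
structure IsInvolution (J : H → H) : Prop where
  map_comb : ∀ (a b : ℂ) (φ ψ : H), J (a • φ + b • ψ) = conj a • J φ + conj b • J ψ
  sq : ∀ φ : H, J (J φ) = φ
  inner_map : ∀ φ ψ : H, ⟪J ψ, J φ⟫_ℂ = ⟪φ, ψ⟫_ℂ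

/-- `J (T - zI)⁻¹ φ = (T - z̄I)⁻¹ J φ` for all `φ` and all nonreal `z`, where `T` is a selfadjoint
relation (so that the two resolvents are everywhere defined operators). -/
def CommutesWith (J : H → H) (T : Submodule ℂ (H × H)) : Prop :=
  ∀ z : ℂ, z.im ≠ 0 → ∀ φ η : H, ResolventRel T z φ η → ResolventRel T (conj z) (J φ) (J η)

variable (H) in
/-- The class `𝒮(H)` of regular, closed, symmetric operators whose deficiency indices are both
equal to one. -/
def classS : Set (H →ₗ.[ℂ] H) :=
  {A | A.IsClosed ∧ IsSymmetricOp A ∧ IsRegularOp A ∧ HasDeficiencyIndicesOne A}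

variable (H) in
/-- The class `ℰₙ` of `n`-entire operators with `n ≥ 0`. -/
def classENonneg (n : ℕ) : Set (H →ₗ.[ℂ] H) :=
  {A | A ∈ classS H ∧ ∃ μ : Fin (n + 1) → H, ∀ z : ℂ,
    IsCompl (ran A z) (Submodule.span ℂ {∑ k : Fin (n + 1), z ^ (k : ℕ) • μ k})}

variable (H) in
/-- The class `ℰ₋ₙ` of `(-n)`-entire operators with `n ≥ 1`. -/
def classENeg (n : ℕ) : Set (H →ₗ.[ℂ] H) :=
  {A | A ∈ classENonneg H 0 ∧ ∃ μ ∈ domPow A n, ∀ z : ℂ,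
    IsCompl (ran A z) (Submodule.span ℂ {μ})}

variable (H) in
/-- The class `ℰₙ` of `n`-entire operators, for an arbitrary integer `n`. -/
def classE : ℤ → Set (H →ₗ.[ℂ] H)
  | Int.ofNat n => classENonneg H n
  | Int.negSucc m => classENeg H (m + 1)

/-! ### The functional model -/

/-- `ξ` has the properties (P1) zero-free and entire, (P2) `ξ z ∈ ker (A* - zI)`,
(P3) `J (ξ z) = ξ z̄`. -/
structure IsModelFunction (A : H →ₗ.[ℂ] H) (J : H → H) (ξ : ℂ → H) : Prop where
  entire : Differentiable ℂ ξ
  ne_zero : ∀ z, ξ z ≠ 0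
  mem_ker : ∀ z, (ξ z, z • ξ z) ∈ A.graph.adjoint
  map_conj : ∀ z, J (ξ z) = ξ (conj z)

/-- `(Φ φ)(z) = ⟪ξ z̄, φ⟫`. -/
def Phi (ξ : ℂ → H) : H →ₗ[ℂ] (ℂ → ℂ) where
  toFun φ := fun z => ⟪ξ (conj z), φ⟫_ℂ
  map_add' φ ψ := by
    funext z
    simp
  map_smul' a φ := by
    funext z
    simp

/-- The function space `Φ H`. -/
def modelSpace (ξ : ℂ → H) : Submodule ℂ (ℂ → ℂ) :=
  LinearMap.range (Phi ξ)

end Operators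

/-! ### Associated functions of a linear space of functions on `ℂ`

These notions involve only the linear structure of a de Branges space. -/

section Associated

/-- Multiplication by the independent variable on all functions. -/
def mulVar : Module.End ℂ (ℂ → ℂ) where
  toFun f := fun z => z * f z
  map_add' f g := by
    funext z
    simp [mul_add]
  map_smul' a f := by
    funext z
    simp [mul_left_comm]

/-- The operator `S` of multiplication by the independent variable in `B`, with
`dom S = {f ∈ B : z f(z) ∈ B}`. -/
def multOp (B : Submodule ℂ (ℂ → ℂ)) : B →ₗ.[ℂ] B where
  domain := (B.comap mulVar).comap B.subtype
  toFun := LinearMap.codRestrict B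
    ((mulVar ∘ₗ B.subtype) ∘ₗ ((B.comap mulVar).comap B.subtype).subtype)
    (fun f => f.2)

/-- The space of `n`-associated functions of `B`: it is `B + zB + ⋯ + zⁿB` for `n ≥ 0`, and
the domain of `S ^ |n|` for `n < 0`. -/
def assoc (B : Submodule ℂ (ℂ → ℂ)) : ℤ → Submodule ℂ (ℂ → ℂ)
  | Int.ofNat n => ⨆ k ∈ Finset.range (n + 1), B.map (mulVar ^ k)
  | Int.negSucc m => (domPow (multOp B) (m + 1)).map B.subtype

end Associated

end

end NEntire

namespace NEntire

open scoped ComplexConjugate InnerProductSpace Topology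
open Filter

/-! ### Closed ranges and lower bounds for `A - zI`. -/

section Ranges

variable {H : Type*} [NormedAddCommGroup H] [InnerProductSpace ℂ H] {A : H →ₗ.[ℂ] H}

/-! The point is that `ran A z` is the kernel of the nonzero functional `v ↦ Phi ξ v z` for every
`z`, real ones included (`IsModelFunction.mem_ran_iff`). So `span {v}` is a complement exactly when
`Phi ξ v z ≠ 0`, and a gauge for `A` is the same thing as a zero-free function. For `n ≥ 0`, `Phi`
sends a polynomial with coefficients in `H` to an element of `assoc`. For `n < 0`, `Phi` must also
identify `dom (A ^ |n|)` with `dom (S ^ |n|)`; this needs `Phi` injective, that is, `A` simple,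
which follows from a Liouville argument for the solution of `(A - zI) η z = v`. At real `z` the
deficiency index is not given; `IsModelFunction.exists_smul_eq` obtains it by perturbing from a
nearby nonreal point. -/

theorem mem_ran {z : ℂ} {x : H} : x ∈ ran A z ↔ ∃ φ : A.domain, A φ - z • (φ : H) = x :=
  Iff.rfl

theorem IsSymmetricOp.inner_eq (hA : IsSymmetricOp A) (φ ψ : A.domain) :
    ⟪A φ, (ψ : H)⟫_ℂ = ⟪(φ : H), A ψ⟫_ℂ :=
  sub_eq_zero.1 ((Submodule.mem_adjoint_iff _ _).1 (hA (A.mem_graph ψ)) _ _ (A.mem_graph φ))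

/-- By symmetry the imaginary part of `⟪φ, (A - z)φ⟫` is `-Im z ‖φ‖²`; then Cauchy–Schwarz. -/
theorem IsSymmetricOp.abs_im_mul_norm_le (hA : IsSymmetricOp A) (z : ℂ) (φ : A.domain) :
    |z.im| * ‖(φ : H)‖ ≤ ‖A φ - z • (φ : H)‖ := by
  have hreal : (⟪(φ : H), A φ⟫_ℂ).im = 0 := by
    rw [← Complex.conj_eq_iff_im, inner_conj_symm, hA.inner_eq]
  have him : (⟪(φ : H), A φ - z • (φ : H)⟫_ℂ).im = -(z.im * ‖(φ : H)‖ ^ 2) := by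
    rw [inner_sub_right, inner_smul_right, inner_self_eq_norm_sq_to_K, Complex.sub_im, hreal,
      zero_sub]
    exact congrArg Neg.neg (by rw [← Complex.im_mul_ofReal, Complex.ofReal_pow]; rfl)
  have h1 : |z.im| * ‖(φ : H)‖ ^ 2 ≤ ‖(φ : H)‖ * ‖A φ - z • (φ : H)‖ := by
    calc |z.im| * ‖(φ : H)‖ ^ 2 = |(⟪(φ : H), A φ - z • (φ : H)⟫_ℂ).im| := by
          rw [him, abs_neg, abs_mul, abs_of_nonneg (sq_nonneg ‖(φ : H)‖)]
      _ ≤ ‖⟪(φ : H), A φ - z • (φ : H)⟫_ℂ‖ := Complex.abs_im_le_norm _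
      _ ≤ _ := norm_inner_le_norm _ _
  rcases (norm_nonneg (φ : H)).eq_or_lt with h0 | h0
  · rw [← h0, mul_zero]
    exact norm_nonneg _
  · refine le_of_mul_le_mul_left ?_ h0
    linarith [show ‖(φ : H)‖ * (|z.im| * ‖(φ : H)‖) = |z.im| * ‖(φ : H)‖ ^ 2 by ring]

theorem IsRegularOp.eq_zero (hA : IsRegularOp A) {z : ℂ} {φ : A.domain}
    (h : A φ - z • (φ : H) = 0) : φ = 0 := by
  obtain ⟨c, hc, hb⟩ := hA z
  have := hb φ
  rw [h, norm_zero] at this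
  have h0 : ‖(φ : H)‖ ≤ 0 := nonpos_of_mul_nonpos_right this hc
  exact Subtype.ext (norm_le_zero_iff.1 h0)

variable [CompleteSpace H]

/-- Regularity bounds `(x, y) ↦ y - z x` from below in the norm of the graph, which is complete. -/
theorem isClosed_ran (hcl : A.IsClosed) (hreg : IsRegularOp A) (z : ℂ) :
    IsClosed (ran A z : Set H) := by
  obtain ⟨c, hc, hb⟩ := hreg z
  have hG : IsClosed (A.graph : Set (H × H)) := hcl
  have : CompleteSpace A.graph := hG.completeSpace_coe
  let L : A.graph →L[ℂ] H :=
    (ContinuousLinearMap.snd ℂ H H - z • ContinuousLinearMap.fst ℂ H H).comp A.graph.subtypeL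
  -- With `r = ‖(A - z)φ‖`: `‖φ‖ ≤ r / c` and `‖A φ‖ ≤ r + ‖z‖ r / c`; the constant is the sum of
  -- both bounds.
  have hK : 0 ≤ 1 + (1 + ‖z‖) / c := by positivity
  have hL : AntilipschitzWith ⟨1 + (1 + ‖z‖) / c, hK⟩ L := by
    refine AddMonoidHomClass.antilipschitz_of_bound L ?_
    rintro ⟨⟨x, y⟩, hxy⟩
    obtain ⟨φ, rfl, rfl⟩ := (LinearPMap.mem_graph_iff A).1 hxy
    change ‖((φ : H), A φ)‖ ≤ (1 + (1 + ‖z‖) / c) * ‖A φ - z • (φ : H)‖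
    have h1 : ‖(φ : H)‖ ≤ ‖A φ - z • (φ : H)‖ / c := by
      rw [le_div_iff₀ hc, mul_comm]
      exact hb φ
    have h2 : ‖A φ‖ ≤ ‖A φ - z • (φ : H)‖ + ‖z‖ * ‖(φ : H)‖ := by
      rw [← norm_smul]
      exact norm_le_norm_sub_add _ _
    have h3 : ‖z‖ * ‖(φ : H)‖ ≤ ‖z‖ * (‖A φ - z • (φ : H)‖ / c) := by gcongr
    have h4 : (1 + (1 + ‖z‖) / c) * ‖A φ - z • (φ : H)‖ = ‖A φ - z • (φ : H)‖ +
        ‖A φ - z • (φ : H)‖ / c + ‖z‖ * (‖A φ - z • (φ : H)‖ / c) := by ring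
    have h5 : 0 ≤ ‖z‖ * (‖A φ - z • (φ : H)‖ / c) := by positivity
    have h6 : 0 ≤ ‖A φ - z • (φ : H)‖ / c := by positivity
    rw [h4, Prod.norm_def]
    refine max_le ?_ ?_ <;> simp only <;> linarith [norm_nonneg (A φ - z • (φ : H))]
  have hr : (ran A z : Set H) = Set.range L := by
    ext x
    constructor
    · rintro ⟨φ, rfl⟩
      exact ⟨⟨_, A.mem_graph φ⟩, rfl⟩
    · rintro ⟨⟨⟨x, y⟩, hxy⟩, rfl⟩
      obtain ⟨φ, rfl, rfl⟩ := (LinearPMap.mem_graph_iff A).1 hxy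
      exact ⟨φ, rfl⟩
  rw [hr]
  exact hL.isClosed_range L.uniformContinuous

theorem orthogonal_orthogonal_ran (hcl : A.IsClosed) (hreg : IsRegularOp A) (z : ℂ) :
    (ran A z)ᗮᗮ = ran A z := by
  rw [Submodule.orthogonal_orthogonal_eq_closure]
  exact (isClosed_ran hcl hreg z).submodule_topologicalClosure_eq

end Ranges

/-! ### A Liouville theorem with blow-up allowed at the real axis. -/

section Liouville

/-- An entire function which is `O(1 / |Im z|)` vanishes. -/
theorem eq_zero_of_abs_im_mul_norm_le {E : Type*} [NormedAddCommGroup E] [NormedSpace ℂ E]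
    {f : ℂ → E} (hf : Differentiable ℂ f) {C : ℝ} (hC : ∀ z, |z.im| * ‖f z‖ ≤ C) (z : ℂ) :
    f z = 0 := by
  -- On `‖w‖ = R` the factor `w² - R²` has modulus `2R |Im w|`, which absorbs the blow-up at `±R`;
  -- the maximum principle carries the bound inside.
  have hbound : ∀ R : ℝ, ‖z‖ < R → ‖z ^ 2 - (R : ℂ) ^ 2‖ * ‖f z‖ ≤ 2 * R * C := by
    intro R hR
    have hR0 : 0 < R := (norm_nonneg z).trans_lt hR
    have hd : Differentiable ℂ fun w : ℂ => (w ^ 2 - (R : ℂ) ^ 2) • f w := by fun_prop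
    rw [← norm_smul]
    refine Complex.norm_le_of_forall_mem_frontier_norm_le (U := Metric.ball 0 R)
      (f := fun w : ℂ => (w ^ 2 - (R : ℂ) ^ 2) • f w) Metric.isBounded_ball
      hd.diffContOnCl ?_ (subset_closure (by simpa using hR))
    intro w hw
    rw [frontier_ball _ hR0.ne', mem_sphere_zero_iff_norm] at hw
    have h1 : w ^ 2 - (R : ℂ) ^ 2 = w * (2 * w.im * Complex.I) := by
      have h2 : (R : ℂ) ^ 2 = w * conj w := by
        rw [Complex.mul_conj, Complex.normSq_eq_norm_sq, hw]
        push_cast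
        rfl
      have h3 : w - conj w = 2 * w.im * Complex.I := by
        rw [Complex.sub_conj]
        push_cast
        ring
      rw [h2, ← h3]
      ring
    have h4 : ‖w ^ 2 - (R : ℂ) ^ 2‖ = 2 * R * |w.im| := by
      rw [h1]
      simp [hw]
      ring
    change ‖(w ^ 2 - (R : ℂ) ^ 2) • f w‖ ≤ _
    rw [norm_smul, h4, mul_assoc]
    exact mul_le_mul_of_nonneg_left (hC w) (by positivity)
  by_contra hne
  have hpos : 0 < ‖f z‖ := norm_pos_iff.2 hne
  have hlim : Tendsto (fun R : ℝ => R * (R * ‖f z‖ - 2 * C)) atTop atTop :=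
    tendsto_id.atTop_mul_atTop₀
      (tendsto_atTop_add_const_right _ (-(2 * C)) (tendsto_id.atTop_mul_const hpos))
  obtain ⟨R, h1, h2⟩ :=
    ((hlim.eventually_gt_atTop (‖z‖ ^ 2 * ‖f z‖)).and (eventually_gt_atTop ‖z‖)).exists
  have h3 : R ^ 2 - ‖z‖ ^ 2 ≤ ‖z ^ 2 - (R : ℂ) ^ 2‖ := by
    have := norm_sub_norm_le ((R : ℂ) ^ 2) (z ^ 2)
    rw [norm_sub_rev (z ^ 2)]
    simpa using this
  have h4 := (mul_le_mul_of_nonneg_right h3 hpos.le).trans (hbound R h2)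
  nlinarith

end Liouville

/-! ### Simplicity of regular symmetric operators. -/

section Resolvent

variable {H : Type*} [NormedAddCommGroup H] [InnerProductSpace ℂ H] [CompleteSpace H]
  {A : H →ₗ.[ℂ] H}

/-- The solution `η` of `(A - zI) η z = v` is an entire function of `z`. -/
theorem differentiable_of_solution (hcl : A.IsClosed) (hreg : IsRegularOp A) {v : H}
    {η : ℂ → A.domain} (hη : ∀ z, A (η z) - z • (η z : H) = v) :
    Differentiable ℂ fun z => (η z : H) := by
  intro w
  obtain ⟨c, hc, hb⟩ := hreg w
  have hdiff : ∀ z, A (η z - η w) - w • ((η z - η w : A.domain) : H) = (z - w) • (η z : H) := by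
    intro z
    have h := hη z
    rw [← hη w] at h
    rw [LinearPMap.map_sub, Submodule.coe_sub, smul_sub, sub_smul]
    rw [← sub_eq_zero] at h ⊢
    rw [← h]
    abel
  have hest : ∀ z, c * ‖(η z : H) - η w‖ ≤ ‖z - w‖ * ‖(η z : H)‖ := by
    intro z
    have := hb (η z - η w)
    rwa [hdiff, norm_smul] at this
  have hcont : Tendsto (fun z => (η z : H)) (𝓝 w) (𝓝 (η w : H)) := by
    have hball : ∀ᶠ z in 𝓝 w, ‖z - w‖ < c / 2 := by
      filter_upwards [Metric.ball_mem_nhds w (half_pos hc)] with z hz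
      rwa [Metric.mem_ball, dist_eq_norm] at hz
    rw [tendsto_iff_norm_sub_tendsto_zero]
    refine squeeze_zero' (g := fun z => 2 * ‖(η w : H)‖ / c * ‖z - w‖)
      (Eventually.of_forall fun _ => norm_nonneg _) ?_ ?_
    · filter_upwards [hball] with z hz
      have h1 := hest z
      have h2 : ‖(η z : H)‖ ≤ ‖(η z : H) - η w‖ + ‖(η w : H)‖ := norm_le_norm_sub_add _ _
      have h3 : ‖z - w‖ * ‖(η z : H)‖ ≤ c / 2 * ‖(η z : H)‖ := by gcongr
      have h4 : ‖(η z : H)‖ ≤ 2 * ‖(η w : H)‖ := by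
        have : c * ‖(η z : H) - η w‖ ≤ c * (‖(η z : H)‖ / 2) := by linarith
        linarith [le_of_mul_le_mul_left this hc]
      rw [div_mul_eq_mul_div, le_div_iff₀ hc]
      calc _ = c * ‖(η z : H) - η w‖ := mul_comm _ _
        _ ≤ ‖z - w‖ * ‖(η z : H)‖ := h1
        _ ≤ ‖z - w‖ * (2 * ‖(η w : H)‖) := by gcongr
        _ = _ := mul_comm _ _
    · have : Tendsto (fun z : ℂ => 2 * ‖(η w : H)‖ / c * ‖z - w‖) (𝓝 w)
          (𝓝 (2 * ‖(η w : H)‖ / c * ‖w - w‖)) :=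
        Continuous.tendsto (by fun_prop) w
      simpa using this
  have hdiff' : ∀ z, z ≠ w →
      A ((z - w)⁻¹ • (η z - η w)) - w • (((z - w)⁻¹ • (η z - η w) : A.domain) : H) = η z := by
    intro z hz
    rw [LinearPMap.map_smul, Submodule.coe_smul, smul_comm w, ← smul_sub, hdiff,
      inv_smul_smul₀ (sub_ne_zero.2 hz)]
  -- The difference quotients are preimages under `A - w` of `η z → η w`. Closedness of the range
  -- gives a preimage `θ` of the limit, and the lower bound makes the quotients converge to it.
  have hmem : (η w : H) ∈ ran A w := by
    refine (isClosed_ran hcl hreg w).mem_of_tendsto (hcont.mono_left nhdsWithin_le_nhds :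
      Tendsto _ (𝓝[≠] w) _) ?_
    filter_upwards [self_mem_nhdsWithin] with z hz
    exact ⟨_, hdiff' z hz⟩
  obtain ⟨θ, hθ⟩ := mem_ran.1 hmem
  have hderiv : HasDerivAt (fun z => (η z : H)) (θ : H) w := by
    rw [hasDerivAt_iff_tendsto_slope, tendsto_iff_norm_sub_tendsto_zero]
    refine squeeze_zero' (g := fun z => ‖(η z : H) - η w‖ / c)
      (Eventually.of_forall fun _ => norm_nonneg _) ?_ ?_
    · filter_upwards [self_mem_nhdsWithin] with z hz
      have h := hb ((z - w)⁻¹ • (η z - η w) - θ)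
      rw [LinearPMap.map_sub, Submodule.coe_sub, smul_sub w, sub_sub_sub_comm, hdiff' z hz, hθ] at h
      rw [le_div_iff₀ hc, mul_comm]
      exact h
    · have := (tendsto_iff_norm_sub_tendsto_zero.1 hcont).div_const c
      rw [zero_div] at this
      exact this.mono_left nhdsWithin_le_nhds
  exact hderiv.differentiableAt

/-- A regular closed symmetric operator is simple. -/
theorem eq_zero_of_forall_mem_ran (hcl : A.IsClosed) (hsym : IsSymmetricOp A)
    (hreg : IsRegularOp A) {v : H} (hv : ∀ z, v ∈ ran A z) : v = 0 := by
  choose η hη using fun z => mem_ran.1 (hv z)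
  have h0 : (η 0 : H) = 0 :=
    eq_zero_of_abs_im_mul_norm_le (differentiable_of_solution hcl hreg hη) (C := ‖v‖)
      (fun z => by simpa only [hη] using hsym.abs_im_mul_norm_le z (η z)) 0
  have h1 : η 0 = 0 := Subtype.ext h0
  rw [← hη 0, h1, LinearPMap.map_zero]
  simp

end Resolvent

/-! ### The functional model and the classes `ℰₙ`. -/

section Model

variable {H : Type*} [NormedAddCommGroup H] [InnerProductSpace ℂ H]
  {A : H →ₗ.[ℂ] H} {J : H → H} {ξ : ℂ → H}

theorem Phi_apply (ξ : ℂ → H) (φ : H) (z : ℂ) : Phi ξ φ z = ⟪ξ (conj z), φ⟫_ℂ :=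
  rfl

theorem differentiable_Phi (hξ : Differentiable ℂ ξ) (φ : H) : Differentiable ℂ (Phi ξ φ) := by
  intro z
  have h : Differentiable ℂ fun w => ⟪φ, ξ w⟫_ℂ := (innerSL ℂ φ).differentiable.comp hξ
  have h2 := (h (conj z)).conj_conj
  rw [Complex.conj_conj] at h2
  refine h2.congr_of_eventuallyEq (Eventually.of_forall fun w => ?_)
  simp [Phi_apply]

theorem IsModelFunction.Phi_map (hξ : IsModelFunction A J ξ) (φ : A.domain) :
    Phi ξ (A φ) = mulVar (Phi ξ φ) := by
  funext z
  have h := (Submodule.mem_adjoint_iff _ _).1 (hξ.mem_ker (conj z)) _ _ (A.mem_graph φ)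
  rw [sub_eq_zero] at h
  have h' := congrArg conj h
  rw [inner_conj_symm, inner_conj_symm, inner_smul_left, Complex.conj_conj] at h'
  exact h'

theorem IsModelFunction.mem_orthogonal (hξ : IsModelFunction A J ξ) (z : ℂ) :
    ξ (conj z) ∈ (ran A z)ᗮ := by
  rw [Submodule.mem_orthogonal']
  rintro _ ⟨φ, rfl⟩
  change Phi ξ (A φ - z • (φ : H)) z = 0
  rw [map_sub, map_smul, hξ.Phi_map]
  exact sub_self _

theorem IsModelFunction.orthogonal_of_im_ne_zero (hξ : IsModelFunction A J ξ)
    (hdef : HasDeficiencyIndicesOne A) {z : ℂ} (hz : z.im ≠ 0) {u : H} (hu : u ∈ (ran A z)ᗮ) :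
    ∃ c : ℂ, c • ξ (conj z) = u := by
  have h1 : Module.finrank ℂ (ran A z)ᗮ = 1 :=
    hz.lt_or_gt.elim (hdef.2 z) (hdef.1 z)
  have hne : (⟨ξ (conj z), hξ.mem_orthogonal z⟩ : (ran A z)ᗮ) ≠ 0 := fun h =>
    hξ.ne_zero _ (congrArg Subtype.val h)
  obtain ⟨c, hc⟩ := (finrank_eq_one_iff_of_nonzero' _ hne).1 h1 ⟨u, hu⟩
  exact ⟨c, congrArg Subtype.val hc⟩

theorem mem_domPow_succ {E : Type*} [AddCommGroup E] [Module ℂ E] {T : E →ₗ.[ℂ] E} {n : ℕ}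
    {x : E} : x ∈ domPow T (n + 1) ↔ ∃ y : T.domain, T y ∈ domPow T n ∧ (y : E) = x :=
  Iff.rfl

theorem mulVar_pow_apply (k : ℕ) (f : ℂ → ℂ) (z : ℂ) : (mulVar ^ k) f z = z ^ k * f z := by
  induction k with
  | zero => simp
  | succ k ih =>
    rw [pow_succ', Module.End.mul_apply, pow_succ', mul_assoc, ← ih]
    rfl

theorem mem_assoc_ofNat_iff {n : ℕ} {f : ℂ → ℂ} :
    f ∈ assoc (modelSpace ξ) (Int.ofNat n) ↔ ∃ μ : Fin (n + 1) → H,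
      ∀ z, f z = Phi ξ (∑ k : Fin (n + 1), z ^ (k : ℕ) • μ k) z := by
  have hsum : ∀ (μ : ℕ → H) (z : ℂ), (∑ k ∈ Finset.range (n + 1), (mulVar ^ k) (Phi ξ (μ k))) z =
      Phi ξ (∑ k : Fin (n + 1), z ^ (k : ℕ) • μ k) z := by
    intro μ z
    rw [Finset.sum_range, Finset.sum_apply, map_sum, Finset.sum_apply]
    refine Finset.sum_congr rfl fun k _ => ?_
    rw [mulVar_pow_apply, map_smul]
    rfl
  change f ∈ (⨆ k ∈ Finset.range (n + 1), (modelSpace ξ).map (mulVar ^ k)) ↔ _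
  rw [Submodule.mem_iSup_finset_iff_exists_sum]
  constructor
  · rintro ⟨g, rfl⟩
    choose x hx hxg using fun k => Submodule.mem_map.1 (g k).2
    choose μ hμ using hx
    refine ⟨fun k => μ k, fun z => ?_⟩
    rw [← hsum]
    simp only [hμ, hxg]
  · rintro ⟨μ, hμ⟩
    -- The supremum is indexed by naturals, so the coefficients are extended by zero; values beyond
    -- `n` play no role.
    let ν : ℕ → H := fun k => if h : k < n + 1 then μ ⟨k, h⟩ else 0
    have hν : ∀ k : Fin (n + 1), ν k = μ k := fun k => dif_pos k.2
    refine ⟨fun k => ⟨_, Submodule.mem_map_of_mem ⟨ν k, rfl⟩⟩, ?_⟩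
    funext z
    rw [hμ, hsum]
    simp only [hν]

theorem differentiable_of_mem_assoc_ofNat (hξ : Differentiable ℂ ξ) {n : ℕ} {f : ℂ → ℂ}
    (hf : f ∈ assoc (modelSpace ξ) (Int.ofNat n)) : Differentiable ℂ f := by
  obtain ⟨μ, hμ⟩ := mem_assoc_ofNat_iff.1 hf
  have : f = fun z => ∑ k : Fin (n + 1), z ^ (k : ℕ) * Phi ξ (μ k) z := by
    funext z
    rw [hμ, map_sum, Finset.sum_apply]
    refine Finset.sum_congr rfl fun k _ => ?_
    rw [map_smul]
    rfl
  rw [this]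
  have := fun k => differentiable_Phi hξ (μ k)
  fun_prop

variable [CompleteSpace H]

/-- A closed range is its own double orthogonal complement. Spanning is a hypothesis because the
nonreal case is used to prove spanning at real points. -/
theorem IsModelFunction.mem_ran_iff_of_orthogonal (hξ : IsModelFunction A J ξ) (hcl : A.IsClosed)
    (hreg : IsRegularOp A) {z : ℂ} (h : ∀ u ∈ (ran A z)ᗮ, ∃ c : ℂ, c • ξ (conj z) = u) (v : H) :
    v ∈ ran A z ↔ Phi ξ v z = 0 := by
  constructor
  · intro hv
    exact Submodule.inner_left_of_mem_orthogonal hv (hξ.mem_orthogonal z)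
  · intro hv
    rw [← orthogonal_orthogonal_ran hcl hreg z, Submodule.mem_orthogonal]
    intro u hu
    obtain ⟨c, rfl⟩ := h u hu
    rw [inner_smul_left, ← Phi_apply, hv, mul_zero]

/-- The deficiency space of `A` is spanned by `ξ z̄` also at real points `z`. -/
theorem IsModelFunction.exists_smul_eq (hξ : IsModelFunction A J ξ) (hA : A ∈ classS H)
    (z : ℂ) {u : H} (hu : u ∈ (ran A z)ᗮ) : ∃ c : ℂ, c • ξ (conj z) = u := by
  obtain ⟨hcl, -, hreg, hdef⟩ := hA
  by_cases hz : z.im = 0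
  swap
  · exact hξ.orthogonal_of_im_ne_zero hdef hz hu
  obtain ⟨c, hc, hb⟩ := hreg z
  have hcont : Continuous fun t : ℝ => ⟪ξ (conj (z + t * Complex.I)), ξ (conj z)⟫_ℂ := by
    have := hξ.entire.continuous
    have hconj : Continuous fun t : ℝ => conj (z + t * Complex.I) :=
      Complex.continuous_conj.comp (by fun_prop)
    exact (this.comp hconj).inner continuous_const
  have hne : ∀ᶠ t : ℝ in 𝓝 0, ⟪ξ (conj (z + t * Complex.I)), ξ (conj z)⟫_ℂ ≠ 0 := by
    refine hcont.continuousAt.eventually_ne ?_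
    simpa using hξ.ne_zero _
  -- The shift `t` stays below the regularity constant `c` at `z` and keeps `ξ w̄` non-orthogonal to
  -- `ξ z̄`.
  obtain ⟨t, ⟨ht, htc⟩, ht0⟩ := (((hne.and (eventually_lt_nhds hc)).filter_mono
    nhdsWithin_le_nhds).and (self_mem_nhdsWithin (s := Set.Ioi (0 : ℝ)))).exists
  have ht0 : 0 < t := ht0
  set w : ℂ := z + t * Complex.I with hw
  have hwim : w.im ≠ 0 := by simp [hw, hz, ht0.ne']
  have hwz : ‖w - z‖ = t := by simp [hw, abs_of_pos ht0]
  set a := ⟪ξ (conj w), ξ (conj z)⟫_ℂ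
  set b := ⟪ξ (conj w), u⟫_ℂ
  -- This combination is orthogonal to `ξ w̄`, hence equals `(A - w)φ`. It is also orthogonal to `x
  -- = (A - z)φ`, so `c‖φ‖ ≤ ‖x‖ ≤ t‖φ‖` with `t < c` forces `φ = 0`.
  have hv : b • ξ (conj z) - a • u ∈ (ran A z)ᗮ :=
    Submodule.sub_mem _ (Submodule.smul_mem _ _ (hξ.mem_orthogonal z)) (Submodule.smul_mem _ _ hu)
  have hv' : b • ξ (conj z) - a • u ∈ ran A w := by
    rw [hξ.mem_ran_iff_of_orthogonal hcl hreg
      (fun _ h => hξ.orthogonal_of_im_ne_zero hdef hwim h), Phi_apply, inner_sub_right,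
      inner_smul_right, inner_smul_right]
    change b * a - a * b = 0
    ring
  obtain ⟨φ, hφ⟩ := mem_ran.1 hv'
  set x := A φ - z • (φ : H) with hx
  have hxv : x = (b • ξ (conj z) - a • u) + (w - z) • (φ : H) := by
    rw [hx, ← hφ, sub_smul]
    abel
  have h1 : ⟪x, x⟫_ℂ = (w - z) * ⟪x, (φ : H)⟫_ℂ := by
    have h0 : ⟪x, b • ξ (conj z) - a • u⟫_ℂ = 0 :=
      Submodule.inner_right_of_mem_orthogonal (mem_ran.2 ⟨φ, rfl⟩) hv
    conv_lhs => rw [hxv, ← hxv]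
    nth_rewrite 2 [hxv]
    rw [inner_add_right, h0, inner_smul_right, zero_add]
  have h2 : ‖x‖ * ‖x‖ ≤ ‖x‖ * (t * ‖(φ : H)‖) := by
    have h3 := congrArg norm h1
    rw [norm_mul, hwz, inner_self_eq_norm_sq_to_K] at h3
    have h4 := norm_inner_le_norm (𝕜 := ℂ) x (φ : H)
    have h5 : ‖x‖ ^ 2 = t * ‖⟪x, (φ : H)⟫_ℂ‖ := by simpa using h3
    nlinarith [mul_le_mul_of_nonneg_left h4 ht0.le]
  have h6 : ‖x‖ ≤ t * ‖(φ : H)‖ := by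
    rcases (norm_nonneg x).eq_or_lt with h0 | h0
    · rw [← h0]
      positivity
    · exact le_of_mul_le_mul_left h2 h0
  have h7 : (φ : H) = 0 := by
    have := (hb φ).trans h6
    by_contra hne
    have := norm_pos_iff.2 hne
    nlinarith
  have h8 : φ = 0 := Subtype.ext h7
  have h9 : b • ξ (conj z) = a • u := by
    rw [← sub_eq_zero, ← hφ, h8, LinearPMap.map_zero]
    simp
  exact ⟨a⁻¹ * b, by rw [mul_smul, h9, inv_smul_smul₀ ht]⟩

theorem IsModelFunction.mem_ran_iff (hξ : IsModelFunction A J ξ) (hA : A ∈ classS H) (z : ℂ)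
    (v : H) : v ∈ ran A z ↔ Phi ξ v z = 0 :=
  hξ.mem_ran_iff_of_orthogonal hA.1 hA.2.2.1 (fun _ h => hξ.exists_smul_eq hA z h) v

theorem IsModelFunction.isCompl_iff (hξ : IsModelFunction A J ξ) (hA : A ∈ classS H) (z : ℂ)
    (v : H) : IsCompl (ran A z) (Submodule.span ℂ {v}) ↔ Phi ξ v z ≠ 0 := by
  constructor
  · intro h h0
    have hle : Submodule.span ℂ {v} ≤ ran A z := by
      rw [Submodule.span_singleton_le_iff_mem, hξ.mem_ran_iff hA]
      exact h0
    have htop : ran A z = ⊤ := by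
      rw [← h.sup_eq_top, sup_eq_left.2 hle]
    have hmem : ξ (conj z) ∈ ran A z := htop ▸ Submodule.mem_top
    rw [hξ.mem_ran_iff hA, Phi_apply, inner_self_eq_zero] at hmem
    exact hξ.ne_zero _ hmem
  · intro h
    constructor
    · rw [Submodule.disjoint_def]
      intro x hx hxv
      obtain ⟨a, rfl⟩ := Submodule.mem_span_singleton.1 hxv
      rw [hξ.mem_ran_iff hA, map_smul] at hx
      have : a * Phi ξ v z = 0 := hx
      rw [(mul_eq_zero.1 this).resolve_right h, zero_smul]
    · rw [codisjoint_iff, eq_top_iff]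
      intro x _
      refine Submodule.mem_sup.2 ⟨x - (Phi ξ x z / Phi ξ v z) • v, ?_,
        (Phi ξ x z / Phi ξ v z) • v, Submodule.smul_mem _ _ (Submodule.mem_span_singleton_self v),
        sub_add_cancel _ _⟩
      rw [hξ.mem_ran_iff hA, map_sub, map_smul]
      change Phi ξ x z - Phi ξ x z / Phi ξ v z * Phi ξ v z = 0
      rw [div_mul_cancel₀ _ h, sub_self]

theorem IsModelFunction.Phi_injective (hξ : IsModelFunction A J ξ) (hA : A ∈ classS H) :
    Function.Injective (Phi ξ) := by
  rw [injective_iff_map_eq_zero]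
  intro v hv
  refine eq_zero_of_forall_mem_ran hA.1 hA.2.1 hA.2.2.1 fun z => ?_
  rw [hξ.mem_ran_iff hA, hv]
  rfl

/-- `Φ` carries `A` onto the operator of multiplication by the independent variable. -/
theorem IsModelFunction.exists_mem_domain_of_mulVar (hξ : IsModelFunction A J ξ)
    (hA : A ∈ classS H) {φ ψ : H} (h : mulVar (Phi ξ φ) = Phi ξ ψ) :
    ∃ η : A.domain, (η : H) = φ ∧ A η = ψ := by
  have happ : ∀ w, w * Phi ξ φ w = Phi ξ ψ w := fun w => congrFun h w
  -- `Phi ξ ψ` vanishes at `0`, so `ψ = A η`. Then `Phi ξ η` and `Phi ξ φ` agree off `0`, hence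
  -- everywhere by continuity.
  obtain ⟨η, hη⟩ := mem_ran.1 ((hξ.mem_ran_iff hA 0 ψ).2 (by rw [← happ, zero_mul]))
  rw [zero_smul, sub_zero] at hη
  refine ⟨η, hξ.Phi_injective hA ?_, hη⟩
  have hmul : mulVar (Phi ξ η) = mulVar (Phi ξ φ) := by rw [← hξ.Phi_map, hη, h]
  refine ((differentiable_Phi hξ.entire _).continuous.ext_on (dense_compl_singleton (0 : ℂ))
    (differentiable_Phi hξ.entire _).continuous ?_)
  intro w hw
  exact mul_left_cancel₀ hw (congrFun hmul w)

theorem IsModelFunction.mem_domPow_iff (hξ : IsModelFunction A J ξ) (hA : A ∈ classS H) (n : ℕ)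
    (φ : H) : (⟨Phi ξ φ, φ, rfl⟩ : modelSpace ξ) ∈ domPow (multOp (modelSpace ξ)) n ↔
      φ ∈ domPow A n := by
  induction n generalizing φ with
  | zero => simp [domPow]
  | succ n ih =>
    rw [mem_domPow_succ, mem_domPow_succ]
    constructor
    · rintro ⟨⟨_, ψ, hψ⟩, hy, rfl⟩
      obtain ⟨η, rfl, rfl⟩ := hξ.exists_mem_domain_of_mulVar hA hψ.symm
      refine ⟨η, (ih _).1 ?_, rfl⟩
      convert hy using 1
      exact Subtype.ext hψ
    · rintro ⟨η, hη, rfl⟩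
      refine ⟨⟨⟨Phi ξ η, η, rfl⟩, A η, hξ.Phi_map η⟩, ?_, rfl⟩
      convert (ih _).2 hη using 1
      exact Subtype.ext (hξ.Phi_map η).symm

theorem IsModelFunction.mem_assoc_negSucc_iff (hξ : IsModelFunction A J ξ) (hA : A ∈ classS H)
    (m : ℕ) {f : ℂ → ℂ} :
    f ∈ assoc (modelSpace ξ) (Int.negSucc m) ↔ ∃ μ ∈ domPow A (m + 1), Phi ξ μ = f := by
  constructor
  · rintro ⟨⟨_, μ, rfl⟩, hf, rfl⟩
    exact ⟨μ, (hξ.mem_domPow_iff hA _ μ).1 hf, rfl⟩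
  · rintro ⟨μ, hμ, rfl⟩
    exact ⟨_, (hξ.mem_domPow_iff hA _ μ).2 hμ, rfl⟩

theorem IsModelFunction.mem_classENonneg_iff (hξ : IsModelFunction A J ξ) (hA : A ∈ classS H)
    (n : ℕ) : A ∈ classENonneg H n ↔
      ∃ f ∈ assoc (modelSpace ξ) (Int.ofNat n), Differentiable ℂ f ∧ ∀ z, f z ≠ 0 := by
  constructor
  · rintro ⟨-, μ, hμ⟩
    have hf := mem_assoc_ofNat_iff (ξ := ξ) (n := n)
      (f := fun z => Phi ξ (∑ k : Fin (n + 1), z ^ (k : ℕ) • μ k) z) |>.2 ⟨μ, fun z => rfl⟩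
    exact ⟨_, hf, differentiable_of_mem_assoc_ofNat hξ.entire hf,
      fun z => (hξ.isCompl_iff hA z _).1 (hμ z)⟩
  · rintro ⟨f, hf, -, h0⟩
    obtain ⟨μ, hμ⟩ := mem_assoc_ofNat_iff.1 hf
    exact ⟨hA, μ, fun z => (hξ.isCompl_iff hA z _).2 (hμ z ▸ h0 z)⟩

theorem IsModelFunction.mem_classENeg_iff (hξ : IsModelFunction A J ξ) (hA : A ∈ classS H)
    (m : ℕ) : A ∈ classENeg H (m + 1) ↔
      ∃ f ∈ assoc (modelSpace ξ) (Int.negSucc m), Differentiable ℂ f ∧ ∀ z, f z ≠ 0 := by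
  constructor
  · rintro ⟨-, μ, hμ, h⟩
    exact ⟨Phi ξ μ, (hξ.mem_assoc_negSucc_iff hA m).2 ⟨μ, hμ, rfl⟩,
      differentiable_Phi hξ.entire μ, fun z => (hξ.isCompl_iff hA z _).1 (h z)⟩
  · rintro ⟨f, hf, -, h0⟩
    obtain ⟨μ, hμ, rfl⟩ := (hξ.mem_assoc_negSucc_iff hA m).1 hf
    have h : ∀ z, IsCompl (ran A z) (Submodule.span ℂ {μ}) :=
      fun z => (hξ.isCompl_iff hA z _).2 (h0 z)
    -- The same gauge `μ`, as a constant family, witnesses membership in `ℰ₀`.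
    exact ⟨⟨hA, fun _ => μ, fun z => by simpa using h z⟩, μ, hμ, h⟩

end Model

end NEntire

theorem mainTheorem3 {H : Type*} [NormedAddCommGroup H] [InnerProductSpace ℂ H] [CompleteSpace H]
    (A : H →ₗ.[ℂ] H) (hA : A ∈ NEntire.classS H)
    (J : H → H) (hJ : NEntire.IsInvolution J)
    (hJA : ∀ T : Submodule ℂ (H × H), NEntire.IsCanonicalSelfadjointExtension A T →
      NEntire.CommutesWith J T)
    (ξ : ℂ → H) (hξ : NEntire.IsModelFunction A J ξ) (n : ℤ) :
    A ∈ NEntire.classE H n ↔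
      ∃ f ∈ NEntire.assoc (NEntire.modelSpace ξ) n, Differentiable ℂ f ∧ ∀ z : ℂ, f z ≠ 0 := by
  cases n with
  | ofNat n => exact hξ.mem_classENonneg_iff hA n
  | negSucc m => exact hξ.mem_classENeg_iff hA m
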